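/- Let $\mathcal A,\mathcal B,\mathcal C$ be abelian categories with enough projective objects, and write $\mathcal P_{\mathcal A}$ for the projective objects of $\mathcal A$ (similarly for $\mathcal B$, $\mathcal C$). The stable category $\underline{\mathcal A}$ has the objects of $\mathcal A$, and its morphisms are the morphisms of $\mathcal A$ modulo those that factor through a projective object; $\underline f$ denotes the class of $f$. Objects of $\mathcal A$ are viewed in $D^b(\mathcal A)$ as complexes concentrated in degree $0$. A triangle functor $F\colon D^b(\mathcal A)\to D^b(\mathcal B)$ is called non-negative if (1) for every $X\in\mathcal A$, the complex $F(X)$ has zero homology in all negative degrees, and (2) for every $P\in\mathcal P_{\mathcal A}$, $F(P)$ is isomorphic in $D^b(\mathcal B)$ to a bounded complex of projective objects of $\mathcal B$ with zero terms in all negative degrees. For such an $F$ and each $X\in\mathcal A$ there is a distinguished triangle $$U_X\longrightarrow F(X)\xrightarrow{\ \pi_X\ }M_X\longrightarrow U_X[1]$$ in $D^b(\mathcal B)$ with $M_X\in\mathcal B$ and $U_X$ isomorphic to a complex of projective objects of $\mathcal B$ with zero terms outside the degrees $1,\dots,n_X$ for some $n_X>0$. Fix one such triangle for every $X$. For every $f\colon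 X\to Y$ in $\mathcal A$ there is a morphism $b_f\colon M_X\to M_Y$ in $\mathcal B$ such that $b_f\circ\pi_X=\pi_Y\circ F(f)$; its class $\underline{b_f}$ depends only on $\underline f$. The stable functor $\bar F\colon\underline{\mathcal A}\to\underline{\mathcal B}$ of $F$ is defined by $\bar F(X)=M_X$ and $\bar F(\underline f)=\underline{b_f}$. **Theorem.** Let $F\colon D^b(\mathcal A)\to D^b(\mathcal B)$ and $G\colon D^b(\mathcal B)\to D^b(\mathcal C)$ be non-negative triangle functors. Then the composite $GF\colon D^b(\mathcal A)\to D^b(\mathcal C)$ is non-negative, and for all choices of the triangles defining the stable functors $\bar F$, $\bar G$ and $\overline{GF}$ there is an isomorphism of functors $\bar G\circ\bar F\cong\overline{GF}\colon\underline{\mathcal A}\to\underline{\mathcal C}$. -/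

import Mathlib

open CategoryTheory Limits Pretriangulated

universe w₁ w₂ w₃ v₁ v₂ v₃ u₁ u₂ u₃

namespace StableFun

section StableCategory
variable (A : Type*) [Category* A] [Abelian A]

/-- Two parallel morphisms are identified in the stable category when their difference factors
through a projective object. -/
def stableRel : HomRel A := fun X Y f g =>
  ∃ (P : A) (_ : Projective P) (u : X ⟶ P) (v : P ⟶ Y), f - g = u ≫ v

instance stableRel_congruence : Congruence (stableRel A) where
  equivalence := fun {X Y} =>
    { refl := fun f => ⟨⊥_ A, (initialIsInitial.isZero).projective, 0, 0, by simp⟩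
      symm := by
        rintro f g ⟨P, hP, u, v, h⟩
        exact ⟨P, hP, -u, v, by rw [Preadditive.neg_comp, ← h, neg_sub]⟩
      trans := by
        rintro f g k ⟨P, hP, u, v, h⟩ ⟨P', hP', u', v', h'⟩
        exact ⟨P ⊞ P', inferInstance, biprod.lift u u', biprod.desc v v', by
          rw [biprod.lift_desc, ← h, ← h', sub_add_sub_cancel]⟩ }
  comp_left := by
    rintro X Y Z f g g' ⟨P, hP, u, v, h⟩
    exact ⟨P, hP, f ≫ u, v, by rw [← Preadditive.comp_sub, h, Category.assoc]⟩
  comp_right := by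
    rintro X Y Z f f' g ⟨P, hP, u, v, h⟩
    exact ⟨P, hP, u, v ≫ g, by rw [← Preadditive.sub_comp, h, Category.assoc]⟩

/-- The stable category of `A`: the additive quotient of `A` by its projective objects. -/
abbrev StableCategory := CategoryTheory.Quotient (stableRel A)

/-- The canonical functor from `A` to its stable category. -/
abbrev toStable : A ⥤ StableCategory A := CategoryTheory.Quotient.functor (stableRel A)

instance : Preadditive (StableCategory A) :=
  CategoryTheory.Quotient.preadditive (stableRel A) (by
    rintro X Y f₁ f₂ g₁ g₂ ⟨P, hP, u, v, h⟩ ⟨P', hP', u', v', h'⟩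
    exact ⟨P ⊞ P', inferInstance, biprod.lift u u', biprod.desc v v', by
      rw [biprod.lift_desc, ← h, ← h', add_sub_add_comm]⟩)

end StableCategory

noncomputable section
universe w v u w' v' u'
variable {B : Type u} [Category.{v} B] [Abelian B] [HasDerivedCategory.{w} B]

variable (B) in
/-- The embedding of `B` in its bounded derived category, as complexes concentrated in degree `0`. -/
def single0 : B ⥤ DerivedCategory.Bounded B :=
  DerivedCategory.TStructure.t.bounded.lift (DerivedCategory.singleFunctor B 0)
    (fun _ => ⟨⟨0, inferInstance⟩, ⟨0, inferInstance⟩⟩)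

variable (B) in
def single0CompIso : single0 B ⋙ DerivedCategory.Bounded.ι ≅ DerivedCategory.singleFunctor B 0 :=
  Iso.refl _

instance : (single0 B).Full := Functor.Full.of_comp_faithful_iso (single0CompIso B)
instance : (single0 B).Faithful := Functor.Faithful.of_comp_iso (single0CompIso B)
instance : (single0 B).Additive where
  map_add {_ _ f g} := DerivedCategory.Bounded.ι.map_injective
    (((DerivedCategory.singleFunctor B 0).map_add (f := f) (g := g)).trans
      (DerivedCategory.Bounded.ι.map_add (f := (single0 B).map f) (g := (single0 B).map g)).symm)

variable (B) in
/-- The objects of the derived category isomorphic to a complex of projective objects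
with zero terms outside the degrees `m, …, n`. -/
def projComplexes (m n : ℤ) : ObjectProperty (DerivedCategory B) := fun Y =>
  ∃ K : CochainComplex B ℤ, K.IsStrictlyGE m ∧ K.IsStrictlyLE n ∧
    (∀ i, Projective (K.X i)) ∧ Nonempty (Y ≅ DerivedCategory.Q.obj K)

/-- Morphisms in the derived category out of a K-projective complex come from chain maps. -/
lemma exists_chainMap {K L : CochainComplex B ℤ} [K.IsKProjective]
    (g : DerivedCategory.Q.obj K ⟶ DerivedCategory.Q.obj L) :
    ∃ φ : K ⟶ L, DerivedCategory.Q.map φ = g := by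
  obtain ⟨φ, hφ⟩ := (CochainComplex.IsKProjective.Qh_map_bijective K
    ((HomotopyCategory.quotient _ _).obj L)).surjective
    ((DerivedCategory.quotientCompQhIso B).hom.app K ≫ g ≫
      (DerivedCategory.quotientCompQhIso B).inv.app L)
  obtain ⟨φ, rfl⟩ := (HomotopyCategory.quotient _ _).map_surjective φ
  refine ⟨φ, ?_⟩
  have := DerivedCategory.quotientCompQhIso_hom_naturality φ
  rw [hφ, Category.assoc, Category.assoc, Iso.inv_hom_id_app, Category.comp_id,
    cancel_epi] at this
  exact this.symm

lemma hom_to_single_eq_zero {n : ℤ} {Y : DerivedCategory B} (hY : projComplexes B 1 n Y) {M : B}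
    (g : Y ⟶ (DerivedCategory.singleFunctor B 0).obj M) : g = 0 := by
  obtain ⟨K, _, _, _, ⟨e⟩⟩ := hY
  change Y ⟶ DerivedCategory.Q.obj ((HomologicalComplex.single B (.up ℤ) 0).obj M) at g
  change g = 0
  have := CochainComplex.isKProjective_of_projective K n
  obtain ⟨φ, hφ⟩ := exists_chainMap (e.inv ≫ g)
  have h0 : φ = 0 := HomologicalComplex.to_single_hom_ext
    ((K.isZero_of_isStrictlyGE 1 0 (by lia)).eq_of_src _ _)
  rw [← cancel_epi e.inv, ← hφ, h0, Functor.map_zero, comp_zero]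

/-- A morphism of `B` that factors in the derived category through a complex of projective objects in
degrees `0, …, n` factors through a projective object of `B`. -/
lemma factors_of_factors {n : ℤ} {Y : DerivedCategory B} (hY : projComplexes B 0 n Y) {M N : B}
    (f : (DerivedCategory.singleFunctor B 0).obj M ⟶ Y)
    (g : Y ⟶ (DerivedCategory.singleFunctor B 0).obj N) :
    ∃ (P : B) (_ : Projective P) (a : M ⟶ P) (b : P ⟶ N),
      (DerivedCategory.singleFunctor B 0).map (a ≫ b) = f ≫ g := by
  obtain ⟨K, _, _, hK, ⟨e⟩⟩ := hY
  change Y ⟶ DerivedCategory.Q.obj ((HomologicalComplex.single B (.up ℤ) 0).obj N) at g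
  change DerivedCategory.Q.obj ((HomologicalComplex.single B (.up ℤ) 0).obj M) ⟶ Y at f
  have := CochainComplex.isKProjective_of_projective K n
  obtain ⟨φ, hφ⟩ := exists_chainMap (e.inv ≫ g)
  let p : K ⟶ (HomologicalComplex.single B (.up ℤ) 0).obj (K.X 0) :=
    HomologicalComplex.mkHomToSingle (𝟙 _) (fun i hi =>
      (K.isZero_of_isStrictlyGE 0 i (by simp at hi; lia)).eq_of_src _ _)
  obtain ⟨b, hpb⟩ : ∃ b : K.X 0 ⟶ N, p ≫ (HomologicalComplex.single B (.up ℤ) 0).map b = φ :=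
    ⟨φ.f 0 ≫ (HomologicalComplex.singleObjXSelf (.up ℤ) 0 N).hom, by
      apply HomologicalComplex.to_single_hom_ext
      simp [p, HomologicalComplex.single_map_f_self]⟩
  obtain ⟨a, ha⟩ := (DerivedCategory.singleFunctor B 0).map_surjective
    (X := M) (Y := K.X 0) (f ≫ e.hom ≫ DerivedCategory.Q.map p)
  change DerivedCategory.Q.map ((HomologicalComplex.single B (.up ℤ) 0).map a) = _ at ha
  refine ⟨K.X 0, hK 0, a, b, ?_⟩
  change DerivedCategory.Q.map ((HomologicalComplex.single B (.up ℤ) 0).map (a ≫ b)) = f ≫ g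
  have h1 : g = e.hom ≫ DerivedCategory.Q.map φ := by
    rw [hφ, e.hom_inv_id_assoc]
  rw [h1, ← hpb, Functor.map_comp, Functor.map_comp, Functor.map_comp, ha]
  exact (Category.assoc _ _ _).trans (congrArg _ (Category.assoc _ _ _))

lemma projComplexes_shift {n : ℤ} {Y : DerivedCategory B} (hY : projComplexes B 1 n Y) :
    projComplexes B 0 (n - 1) (Y⟦(1 : ℤ)⟧) := by
  obtain ⟨K, _, _, hK, ⟨e⟩⟩ := hY
  exact ⟨K⟦(1 : ℤ)⟧, K.isStrictlyGE_shift 1 1 0 (by lia), K.isStrictlyLE_shift n 1 _ (by lia),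
    fun i => hK _, ⟨(shiftFunctor _ (1 : ℤ)).mapIso e ≪≫
      (DerivedCategory.Q.commShiftIso (1 : ℤ)).symm.app K⟩⟩

lemma projComplexes_of_iso {m n : ℤ} {Y Y' : DerivedCategory B} (e : Y ≅ Y')
    (hY : projComplexes B m n Y') : projComplexes B m n Y := by
  obtain ⟨K, h1, h2, h3, ⟨e'⟩⟩ := hY
  exact ⟨K, h1, h2, h3, ⟨e ≪≫ e'⟩⟩

lemma exists_projective_resolution {A : Type*} [Category* A] [Abelian A] [EnoughProjectives A]
    (K : CochainComplex A ℤ) (n : ℤ) [K.IsStrictlyLE n] :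
    ∃ (P : CochainComplex A ℤ) (f : P ⟶ K), QuasiIso f ∧ (∀ i, Projective (P.X i)) ∧
      P.IsStrictlyLE n := by
  let K' := (CochainComplex.opEquivalence A).functor.obj (Opposite.op K)
  have : K'.IsStrictlyGE (-n) := by
    rw [CochainComplex.isStrictlyGE_iff]
    intro i hi
    exact (K.isZero_of_isStrictlyLE n (-i) (by lia)).op
  obtain ⟨L, i, hi, hL, _⟩ :=
    CochainComplex.Plus.modelCategoryQuillen.exists_quasiIso_injective K' (-n)
  let e := CochainComplex.opEquivalence A
  let P : CochainComplex A ℤ := (e.inverse.obj L).unop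
  let f : P ⟶ K := (e.unitIso.hom.app (Opposite.op K) ≫ e.inverse.map i).unop
  refine ⟨P, f, ?_, fun j => ?_, ?_⟩
  · have h : e.functor.map f.op = i ≫ e.counitIso.inv.app L := by
      simp [f]
    have h2 : QuasiIso (e.functor.map f.op) := by
      rw [h]
      infer_instance
    rw [quasiIso_iff] at h2 ⊢
    intro j
    obtain ⟨m, rfl⟩ : ∃ m, j = -m := ⟨-j, by lia⟩
    have h3 := h2 m
    rw [quasiIsoAt_iff' _ (m - 1) m (m + 1) (by simp) (by simp)] at h3
    rw [quasiIsoAt_iff' _ (-(m + 1)) (-m) (-(m - 1)) (by simp; lia) (by simp; lia),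
      ← ShortComplex.quasiIso_opMap_iff]
    exact h3
  · have := hL (-j)
    change Projective (L.X (-j)).unop
    infer_instance
  · rw [CochainComplex.isStrictlyLE_iff]
    intro j hj
    exact (L.isZero_of_isStrictlyGE (-n) (-j) (by lia)).unop


/-- A distinguished triangle `U ⟶ Y ⟶ M ⟶ U⟦1⟧` in the bounded derived category with `M` an object of
the abelian category and `U` a complex of projective objects in degrees `1, …, n` for some `n > 0`. -/
structure StableTriangle (Y : DerivedCategory.Bounded B) where
  U : DerivedCategory.Bounded B
  M : B
  n : ℤ
  n_pos : 0 < n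
  projComplexes_U : projComplexes B 1 n U.obj
  i : U ⟶ Y
  π : Y ⟶ (single0 B).obj M
  μ : (single0 B).obj M ⟶ U⟦(1 : ℤ)⟧
  distinguished : Triangle.mk i π μ ∈ distTriang (DerivedCategory.Bounded B)

lemma comp_commShiftIso_aux (U : DerivedCategory.Bounded B) {X : DerivedCategory B}
    (f : X ⟶ (DerivedCategory.Bounded.ι.obj U)⟦(1 : ℤ)⟧) :
    ((f ≫ (DerivedCategory.Bounded.ι.commShiftIso (1 : ℤ)).inv.app U) ≫
      (DerivedCategory.Bounded.ι.commShiftIso (1 : ℤ)).hom.app U) ≫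
        (shiftFunctor (DerivedCategory B) (1 : ℤ)).map (𝟙 _) = 𝟙 _ ≫ f := by
  simp

/-- A complex with terms in degrees `0, …, n` whose terms in positive degrees are projective sits in a
stable triangle with third object its term in degree `0`. -/
lemma exists_stableTriangle_of_complex (Y : DerivedCategory.Bounded B) (T : CochainComplex B ℤ)
    (n : ℤ) [T.IsStrictlyGE 0] [T.IsStrictlyLE n] (hT : ∀ i, 0 < i → Projective (T.X i))
    (e : Y.obj ≅ DerivedCategory.Q.obj T) :
    ∃ ξ : StableTriangle Y, ξ.M = T.X 0 := by
  let p : T ⟶ (HomologicalComplex.single B (.up ℤ) 0).obj (T.X 0) :=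
    HomologicalComplex.mkHomToSingle (𝟙 _) (fun i hi =>
      (T.isZero_of_isStrictlyGE 0 i (by simp at hi; lia)).eq_of_src _ _)
  have hp0 : IsIso (p.f 0) := by
    simp only [p, HomologicalComplex.mkHomToSingle_f]
    infer_instance
  have hp : Epi p := by
    have (i : ℤ) : Epi (p.f i) := by
      by_cases hi : i = 0
      · subst hi; infer_instance
      · exact ⟨fun _ _ _ => (HomologicalComplex.isZero_single_obj_X _ _ _ _ hi).eq_of_src _ _⟩
    exact HomologicalComplex.epi_of_epi_f p this
  let K := kernel p
  let S : ShortComplex (CochainComplex B ℤ) := ShortComplex.mk (kernel.ι p) p (by simp)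
  have hS : S.ShortExact :=
    { exact := ShortComplex.exact_of_f_is_kernel _ (kernelIsKernel p)
      mono_f := by dsimp [S]; infer_instance
      epi_g := hp }
  let eK (i : ℤ) : K.X i ≅ kernel (p.f i) :=
    PreservesKernel.iso (HomologicalComplex.eval B (.up ℤ) i) p
  have hK0 (i : ℤ) (hi : i ≤ 0) : IsZero (K.X i) := by
    refine IsZero.of_iso ?_ (eK i)
    rcases hi.lt_or_eq with hi | rfl
    · exact IsZero.of_mono (kernel.ι (p.f i)) (T.isZero_of_isStrictlyGE 0 i hi)
    · exact isZero_kernel_of_mono _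
  have hK1 (i : ℤ) (hi : 0 < i) : Nonempty (K.X i ≅ T.X i) := by
    have h0 : p.f i = 0 := (HomologicalComplex.isZero_single_obj_X _ _ _ _ hi.ne').eq_of_tgt _ _
    exact ⟨eK i ≪≫ kernelIsoOfEq h0 ≪≫ kernelZeroIsoSource⟩
  have hKge : K.IsStrictlyGE 1 := by
    rw [CochainComplex.isStrictlyGE_iff]
    exact fun i hi => hK0 i (by lia)
  have hKle : K.IsStrictlyLE (max n 1) := by
    rw [CochainComplex.isStrictlyLE_iff]
    intro i hi
    obtain ⟨e⟩ := hK1 i (by lia)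
    exact (T.isZero_of_isStrictlyLE n i (by lia)).of_iso e
  let U : DerivedCategory.Bounded B :=
    ⟨DerivedCategory.Q.obj K, ⟨1, K, Iso.refl _, hKge⟩, ⟨max n 1, K, Iso.refl _, hKle⟩⟩
  let i : U ⟶ Y := ObjectProperty.homMk (DerivedCategory.Q.map (kernel.ι p) ≫ e.inv)
  let π : Y ⟶ (single0 B).obj (T.X 0) := ObjectProperty.homMk (e.hom ≫ DerivedCategory.Q.map p)
  let μ : (single0 B).obj (T.X 0) ⟶ U⟦(1 : ℤ)⟧ :=
    DerivedCategory.Bounded.ι.preimage (DerivedCategory.triangleOfSESδ hS ≫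
      (DerivedCategory.Bounded.ι.commShiftIso (1 : ℤ)).inv.app U)
  refine ⟨⟨U, T.X 0, max n 1, by lia, ⟨K, hKge, hKle, fun i => ?_, ⟨Iso.refl _⟩⟩, i, π, μ, ?_⟩, rfl⟩
  · by_cases hi : 0 < i
    · obtain ⟨e⟩ := hK1 i hi
      exact Projective.of_iso e.symm (hT i hi)
    · exact (hK0 i (by lia)).projective
  · refine isomorphic_distinguished _ (DerivedCategory.triangleOfSES_distinguished hS) _ ?_
    refine Triangle.isoMk _ _ (Iso.refl _) e (Iso.refl _) ?_ ?_ ?_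
    · change (DerivedCategory.Q.map (kernel.ι p) ≫ e.inv) ≫ e.hom =
        𝟙 _ ≫ DerivedCategory.Q.map (kernel.ι p)
      simp
    · change (e.hom ≫ DerivedCategory.Q.map p) ≫ 𝟙 _ = e.hom ≫ DerivedCategory.Q.map p
      simp
    · change (DerivedCategory.Bounded.ι.map μ ≫
        (DerivedCategory.Bounded.ι.commShiftIso (1 : ℤ)).hom.app U) ≫
          (shiftFunctor (DerivedCategory B) (1 : ℤ)).map (𝟙 _) =
            𝟙 _ ≫ DerivedCategory.triangleOfSESδ hS
      rw [Functor.map_preimage]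
      exact comp_commShiftIso_aux U (DerivedCategory.triangleOfSESδ hS)

/-- Any bounded complex without homology in negative degrees sits in a stable triangle. -/
lemma nonempty_stableTriangle [EnoughProjectives B] (Y : DerivedCategory.Bounded B)
    (hY : ∀ i < 0, IsZero ((DerivedCategory.homologyFunctor B i).obj Y.obj)) :
    Nonempty (StableTriangle Y) := by
  obtain ⟨n, K, e, hK⟩ := Y.property.2
  obtain ⟨P, f, hf, hP, hPn⟩ := exists_projective_resolution K n
  have hge : (DerivedCategory.Q.obj P).IsGE 0 := by
    rw [DerivedCategory.isGE_iff]
    intro i hi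
    exact (hY i hi).of_iso ((DerivedCategory.homologyFunctor B i).mapIso
      (asIso (DerivedCategory.Q.map f) ≪≫ e.symm))
  rw [DerivedCategory.isGE_Q_obj_iff] at hge
  obtain ⟨ξ, -⟩ := exists_stableTriangle_of_complex Y (P.truncGE 0) n
    (fun i hi => Projective.of_iso (P.truncGEXIso 0 i hi).symm (hP i))
    (e ≪≫ (asIso (DerivedCategory.Q.map f)).symm ≪≫ asIso (DerivedCategory.Q.map (P.πTruncGE 0)))
  exact ⟨ξ⟩

namespace StableTriangle

variable {Y Y' : DerivedCategory.Bounded B}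

/-- Any morphism `g : Y ⟶ Y'` induces a compatible morphism between the third objects of the triangles. -/
lemma exists_lift (ξ : StableTriangle Y) (ξ' : StableTriangle Y') (g : Y ⟶ Y') :
    ∃ b : ξ.M ⟶ ξ'.M, ξ.π ≫ (single0 B).map b = g ≫ ξ'.π := by
  have h : ξ.i ≫ g ≫ ξ'.π = 0 := by
    apply DerivedCategory.Bounded.ι.map_injective
    rw [Functor.map_zero]
    exact hom_to_single_eq_zero ξ.projComplexes_U _
  obtain ⟨c, hc⟩ := Triangle.yoneda_exact₂ _ ξ.distinguished (g ≫ ξ'.π) h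
  obtain ⟨b, rfl⟩ := (single0 B).map_surjective c
  exact ⟨b, hc.symm⟩

/-- A morphism out of `M` that vanishes on `Y` factors through a projective object. -/
lemma factors_of_comp_eq_zero (ξ : StableTriangle Y) {N : B} (b : ξ.M ⟶ N)
    (hb : ξ.π ≫ (single0 B).map b = 0) :
    ∃ (P : B) (_ : Projective P) (u : ξ.M ⟶ P) (v : P ⟶ N), b = u ≫ v := by
  obtain ⟨c, hc⟩ := Triangle.yoneda_exact₃ _ ξ.distinguished ((single0 B).map b) hb
  obtain ⟨P, hP, u, v, h⟩ := factors_of_factors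
    (projComplexes_of_iso ((DerivedCategory.Bounded.ι.commShiftIso (1 : ℤ)).app ξ.U)
      (projComplexes_shift ξ.projComplexes_U))
    (DerivedCategory.Bounded.ι.map ξ.μ) (DerivedCategory.Bounded.ι.map c)
  refine ⟨P, hP, u, v, (DerivedCategory.singleFunctor B 0).map_injective ?_⟩
  rw [h]
  exact congrArg (DerivedCategory.Bounded.ι.map) hc

end StableTriangle


lemma StableTriangle.factors_id (Y : DerivedCategory.Bounded B) {n : ℤ}
    (hY : projComplexes B 0 n Y.obj) (ξ : StableTriangle Y) :
    ∃ (P : B) (_ : Projective P) (u : ξ.M ⟶ P) (v : P ⟶ ξ.M), 𝟙 ξ.M = u ≫ v := by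
  obtain ⟨K, _, _, hK, ⟨e⟩⟩ := hY
  obtain ⟨ξ', hξ'⟩ := exists_stableTriangle_of_complex Y K n (fun i _ => hK i) e
  have hP : Projective ξ'.M := by rw [hξ']; exact hK 0
  obtain ⟨b, hb⟩ := ξ.exists_lift ξ' (𝟙 Y)
  obtain ⟨c, hc⟩ := ξ'.exists_lift ξ (𝟙 Y)
  obtain ⟨P, hP', u, v, h⟩ := ξ.factors_of_comp_eq_zero (𝟙 ξ.M - b ≫ c) (by
    rw [Functor.map_sub, Functor.map_comp, Preadditive.comp_sub, reassoc_of% hb, hc]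
    simp)
  refine ⟨ξ'.M ⊞ P, inferInstance, biprod.lift b u, biprod.desc c v, ?_⟩
  rw [biprod.lift_desc, ← h]
  abel

section StableFunctor
variable {A : Type u'} [Category.{v'} A] [Abelian A] [HasDerivedCategory.{w'} A]
  (F : DerivedCategory.Bounded A ⥤ DerivedCategory.Bounded B)

/-- A functor `F` between bounded derived categories is non-negative if `F(X)` has no homology in
negative degrees for all objects `X` of `A`, and `F(P)` is isomorphic to a bounded complex of projective
objects with zero terms in negative degrees for all projective objects `P` of `A`. -/
structure IsNonNegative : Prop where
  isZero_homology (X : A) (i : ℤ) (hi : i < 0) :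
    IsZero ((DerivedCategory.homologyFunctor B i).obj (F.obj ((single0 A).obj X)).obj)
  projComplexes_obj (P : A) (hP : Projective P) :
    ∃ n : ℤ, projComplexes B 0 n (F.obj ((single0 A).obj P)).obj

/-- The choice of a triangle `U_X ⟶ F(X) ⟶ M_X ⟶ U_X⟦1⟧` for each object `X` of `A`. -/
abbrev StableTriangles := ∀ X : A, StableTriangle (F.obj ((single0 A).obj X))

variable {F}

/-- Such choices exist for a non-negative functor. -/
lemma IsNonNegative.nonempty_stableTriangles [EnoughProjectives B] (hF : IsNonNegative F) :
    Nonempty (StableTriangles F) :=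
  ⟨fun X => (nonempty_stableTriangle _ (hF.isZero_homology X)).some⟩

/-- A morphism `b_f : M_X ⟶ M_Y` with `π_X ≫ b_f = F(f) ≫ π_Y`. -/
def StableTriangles.lift (ξ : StableTriangles F) {X Y : A} (f : X ⟶ Y) : (ξ X).M ⟶ (ξ Y).M :=
  ((ξ X).exists_lift (ξ Y) (F.map ((single0 A).map f))).choose

lemma StableTriangles.π_lift (ξ : StableTriangles F) {X Y : A} (f : X ⟶ Y) :
    (ξ X).π ≫ (single0 B).map (ξ.lift f) = F.map ((single0 A).map f) ≫ (ξ Y).π :=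
  ((ξ X).exists_lift (ξ Y) (F.map ((single0 A).map f))).choose_spec

/-- A morphism out of `M_X` is determined in the stable category by its composite with `π_X`. -/
lemma StableTriangles.toStable_map_eq (ξ : StableTriangles F) {X : A} {N : B}
    (b c : (ξ X).M ⟶ N) (h : (ξ X).π ≫ (single0 B).map b = (ξ X).π ≫ (single0 B).map c) :
    (toStable B).map b = (toStable B).map c :=
  CategoryTheory.Quotient.sound _ ((ξ X).factors_of_comp_eq_zero _ (by
    rw [Functor.map_sub, Preadditive.comp_sub, h, sub_self]))

/-- The stable functor of a non-negative triangle functor `F`, for chosen triangles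
`U_X ⟶ F(X) ⟶ M_X ⟶ U_X⟦1⟧`: it sends `X` to `M_X`, and the class of `f : X ⟶ Y` to the class of `b_f`. -/
def stableFunctor [F.CommShift ℤ] [F.IsTriangulated] (hF : IsNonNegative F)
    (ξ : StableTriangles F) : StableCategory A ⥤ StableCategory B :=
  CategoryTheory.Quotient.lift (stableRel A)
    { obj X := (toStable B).obj (ξ X).M
      map f := (toStable B).map (ξ.lift f)
      map_id X := by
        rw [← CategoryTheory.Functor.map_id]
        exact ξ.toStable_map_eq _ _ (by rw [ξ.π_lift]; simp)
      map_comp f g := by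
        rw [← Functor.map_comp]
        exact ξ.toStable_map_eq _ _ (by
          rw [ξ.π_lift, Functor.map_comp, Functor.map_comp, Functor.map_comp,
            reassoc_of% (ξ.π_lift f), ξ.π_lift, Category.assoc]) }
    (by
      rintro X Y f g ⟨P, hP, u, v, h⟩
      obtain ⟨n, hn⟩ := hF.projComplexes_obj P hP
      obtain ⟨Q, hQ, s, t, hst⟩ := (ξ P).factors_id _ hn
      have h1 : (toStable B).map (ξ.lift f) =
          (toStable B).map (ξ.lift g + ξ.lift u ≫ ξ.lift v) := by
        refine ξ.toStable_map_eq _ _ ?_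
        rw [Functor.map_add, Functor.map_comp, Preadditive.comp_add,
          reassoc_of% (ξ.π_lift u), ξ.π_lift, ξ.π_lift, ξ.π_lift, sub_eq_iff_eq_add'.1 h]
        simp
      refine h1.trans (CategoryTheory.Quotient.sound _ ⟨Q, hQ, ξ.lift u ≫ s, t ≫ ξ.lift v, ?_⟩)
      rw [add_sub_cancel_left, Category.assoc, ← Category.assoc s t, ← hst, Category.id_comp])

end StableFunctor

end
end StableFun

namespace StableFun

noncomputable section
universe w v u w' v' u' w'' v'' u''

/-! ### Complexes of projectives under shifts and cones -/

section ProjComplexes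
variable {B : Type u} [Category.{v} B] [Abelian B] [HasDerivedCategory.{w} B]

/-! The key point is that triangles compose. Apply `G` to the triangle `U_X ⟶ F(X) ⟶ M_X` and follow
`G(π_X)` by the projection `π` of the triangle chosen for `G(M_X)`. By the octahedral axiom the
fibre of the composite is an extension of the complex `U` of the second triangle by `G(U_X)`. If
both are bounded complexes of projectives in degrees at least `1`, so is the fibre, and the
composite projection belongs to a stable triangle for `GF(X)` whose third object is exactly the
value of the composite of the stable functors (`IsNonNegative.exists_comp_distinguished`).

Two facts support this: such complexes are closed under extensions (`exists_projComplexes_obj₂`, via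
mapping cones), and `G` preserves them (`IsNonNegative.exists_projComplexes_map`, by induction on
the number of terms).

It remains to compare two choices of triangles for `GF`. Lifts of the identity give mutually inverse
stable maps between the third objects (`StableTriangle.exists_stableIso`). Naturality follows
because a stable map out of a third object is determined by its composite with the projection. -/

lemma projComplexes_mono {m m' n n' : ℤ} (hm : m' ≤ m) (hn : n ≤ n') {Y : DerivedCategory B}
    (hY : projComplexes B m n Y) : projComplexes B m' n' Y := by
  obtain ⟨K, _, _, hK, e⟩ := hY
  exact ⟨K, K.isStrictlyGE_of_ge m' m hm, K.isStrictlyLE_of_le n n' hn, hK, e⟩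

lemma projComplexes_of_shift {m n : ℤ} {Y : DerivedCategory B}
    (hY : projComplexes B m n (Y⟦(1 : ℤ)⟧)) : projComplexes B (m + 1) (n + 1) Y := by
  obtain ⟨K, _, _, hK, ⟨e⟩⟩ := hY
  exact ⟨K⟦(-1 : ℤ)⟧, K.isStrictlyGE_shift m (-1) _ (by lia),
    K.isStrictlyLE_shift n (-1) _ (by lia), fun i => hK _,
    ⟨(shiftShiftNeg Y (1 : ℤ)).symm ≪≫ (shiftFunctor _ (-1 : ℤ)).mapIso e ≪≫
      (DerivedCategory.Q.commShiftIso (-1 : ℤ)).symm.app K⟩⟩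

lemma projComplexes_of_isZero {m n : ℤ} {Y : DerivedCategory B} (hY : IsZero Y) :
    projComplexes B m n Y := by
  obtain ⟨K, hK⟩ := HasZeroObject.zero (C := CochainComplex B ℤ)
  have hX (i : ℤ) : IsZero (K.X i) := (HomologicalComplex.eval B (.up ℤ) i).map_isZero hK
  refine ⟨K, ?_, ?_, fun i => (hX i).projective, ⟨hY.iso (DerivedCategory.Q.map_isZero hK)⟩⟩
  · rw [CochainComplex.isStrictlyGE_iff]
    exact fun i _ => hX i
  · rw [CochainComplex.isStrictlyLE_iff]
    exact fun i _ => hX i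

lemma isGE_of_projComplexes {m n : ℤ} {Y : DerivedCategory B} (hY : projComplexes B m n Y) :
    DerivedCategory.TStructure.t.IsGE Y m := by
  obtain ⟨K, h, _, _, ⟨e⟩⟩ := hY
  exact ⟨⟨K, e, h⟩⟩

/-- A bounded complex of projectives is K-projective, so the first morphism is represented by a
chain map `φ : K ⟶ L`, whose mapping cone models the third object. Its term in degree `i` is `K.X (i
+ 1) ⊞ L.X i`, which explains the bound `m + 1` on the source. -/
lemma projComplexes_cone {m n : ℤ} (T : Triangle (DerivedCategory B)) (hT : T ∈ distTriang _)
    (h₁ : projComplexes B (m + 1) n T.obj₁) (h₂ : projComplexes B m n T.obj₂) :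
    projComplexes B m n T.obj₃ := by
  obtain ⟨K, _, _, hK, ⟨e₁⟩⟩ := h₁
  obtain ⟨L, _, _, hL, ⟨e₂⟩⟩ := h₂
  have := CochainComplex.isKProjective_of_projective K n
  obtain ⟨φ, hφ⟩ := exists_chainMap (e₁.inv ≫ T.mor₁ ≫ e₂.hom)
  refine ⟨CochainComplex.mappingCone φ, ?_, ?_, fun i => ?_,
    ⟨Triangle.π₃.mapIso (isoTriangleOfIso₁₂ T _ hT
      (DerivedCategory.mappingCone_triangle_distinguished φ) e₁ e₂ ?_)⟩⟩
  · exact CochainComplex.isStrictlyGE_mappingCone φ (m + 1) m m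
  · rw [CochainComplex.isStrictlyLE_iff]
    intro i hi
    rw [CochainComplex.mappingCone.isZero_X_iff]
    exact ⟨K.isZero_of_isStrictlyLE n _ (by lia), L.isZero_of_isStrictlyLE n _ hi⟩
  · have := hK (i + 1)
    have := hL i
    exact Projective.of_iso (HomologicalComplex.homotopyCofiber.XIsoBiprod φ i (i + 1) rfl).symm
      inferInstance
  · change T.mor₁ ≫ e₂.hom = e₁.hom ≫ DerivedCategory.Q.map φ
    rw [hφ, e₁.hom_inv_id_assoc]

end ProjComplexes

/-! ### Extensions and brutal truncation in the bounded derived category -/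

section Bounded
variable {B : Type u} [Category.{v} B] [Abelian B] [HasDerivedCategory.{w} B]

lemma projComplexes_shift_obj {m n : ℤ} {Y : DerivedCategory.Bounded B}
    (hY : projComplexes B m n Y.obj) : projComplexes B (m - 1) (n - 1) (Y⟦(1 : ℤ)⟧).obj := by
  obtain ⟨K, _, _, hK, ⟨e⟩⟩ := hY
  exact ⟨K⟦(1 : ℤ)⟧, K.isStrictlyGE_shift m 1 _ (by lia), K.isStrictlyLE_shift n 1 _ (by lia),
    fun i => hK _, ⟨(DerivedCategory.Bounded.ι.commShiftIso (1 : ℤ)).app Y ≪≫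
      (shiftFunctor _ (1 : ℤ)).mapIso e ≪≫
        (DerivedCategory.Q.commShiftIso (1 : ℤ)).symm.app K⟩⟩

lemma projComplexes_of_shift_obj {m n : ℤ} {Y : DerivedCategory.Bounded B}
    (hY : projComplexes B m n (Y⟦(1 : ℤ)⟧).obj) : projComplexes B (m + 1) (n + 1) Y.obj :=
  projComplexes_of_shift (projComplexes_of_iso
    ((DerivedCategory.Bounded.ι.commShiftIso (1 : ℤ)).symm.app Y) hY)

/-- Complexes of projective objects in degrees at least `m` are closed under extensions. -/
lemma exists_projComplexes_obj₂ {m n n' : ℤ} (T : Triangle (DerivedCategory.Bounded B))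
    (hT : T ∈ distTriang _) (h₁ : projComplexes B m n T.obj₁.obj)
    (h₃ : projComplexes B m n' T.obj₃.obj) : ∃ k, projComplexes B m k T.obj₂.obj := by
  -- After two rotations, `T.obj₂⟦1⟧` is the cone of `T.obj₃ ⟶ T.obj₁⟦1⟧`. The target starts in
  -- degree `m - 1` and the source in degree `m`, as the cone lemma requires.
  have h := projComplexes_cone (m := m - 1) (n := max n n')
    (DerivedCategory.Bounded.ι.mapTriangle.obj T.rotate.rotate)
    (DerivedCategory.Bounded.ι.map_distinguished _
      (rot_of_distTriang _ (rot_of_distTriang _ hT)))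
    (projComplexes_mono (by lia) (by lia) h₃)
    (projComplexes_mono (by lia) (by lia) (projComplexes_shift_obj h₁))
  exact ⟨_, projComplexes_mono (by lia) le_rfl (projComplexes_of_shift_obj h)⟩

lemma isGE_obj₂ {m : ℤ} (T : Triangle (DerivedCategory.Bounded B)) (hT : T ∈ distTriang _)
    (h₁ : DerivedCategory.TStructure.t.IsGE T.obj₁.obj m)
    (h₃ : DerivedCategory.TStructure.t.IsGE T.obj₃.obj m) :
    DerivedCategory.TStructure.t.IsGE T.obj₂.obj m :=
  DerivedCategory.TStructure.t.isGE₂ _ (DerivedCategory.Bounded.ι.map_distinguished _ hT) _ h₁ h₃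

/-- The brutal truncation of a complex of projective objects with terms in degrees `0, …, n`. -/
lemma exists_triangle_of_projComplexes {n : ℤ} (Y : DerivedCategory.Bounded B)
    (hY : projComplexes B 0 n Y.obj) :
    ∃ T ∈ distTriang (DerivedCategory.Bounded B), T.obj₂ = Y ∧
      projComplexes B 1 n T.obj₁.obj ∧
        ∃ (P : B) (_ : Projective P), T.obj₃ = (single0 B).obj P := by
  obtain ⟨T, _, _, hT, ⟨e⟩⟩ := hY
  let p : T ⟶ (HomologicalComplex.single B (.up ℤ) 0).obj (T.X 0) :=
    HomologicalComplex.mkHomToSingle (𝟙 _) (fun i hi =>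
      (T.isZero_of_isStrictlyGE 0 i (by simp at hi; lia)).eq_of_src _ _)
  have hp0 : IsIso (p.f 0) := by
    simp only [p, HomologicalComplex.mkHomToSingle_f]
    infer_instance
  have hp : Epi p := by
    have (i : ℤ) : Epi (p.f i) := by
      by_cases hi : i = 0
      · subst hi; infer_instance
      · exact ⟨fun _ _ _ => (HomologicalComplex.isZero_single_obj_X _ _ _ _ hi).eq_of_src _ _⟩
    exact HomologicalComplex.epi_of_epi_f p this
  let K := kernel p
  let S : ShortComplex (CochainComplex B ℤ) := ShortComplex.mk (kernel.ι p) p (by simp)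
  have hS : S.ShortExact :=
    { exact := ShortComplex.exact_of_f_is_kernel _ (kernelIsKernel p)
      mono_f := by dsimp [S]; infer_instance
      epi_g := hp }
  let eK (i : ℤ) : K.X i ≅ kernel (p.f i) :=
    PreservesKernel.iso (HomologicalComplex.eval B (.up ℤ) i) p
  have hK0 : IsZero (K.X 0) := (isZero_kernel_of_mono _).of_iso (eK 0)
  have hK1 (i : ℤ) (hi : i ≠ 0) : Nonempty (K.X i ≅ T.X i) := by
    have h0 : p.f i = 0 := (HomologicalComplex.isZero_single_obj_X _ _ _ _ hi).eq_of_tgt _ _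
    exact ⟨eK i ≪≫ kernelIsoOfEq h0 ≪≫ kernelZeroIsoSource⟩
  have hK (i : ℤ) (hi : i ≠ 0 → IsZero (T.X i)) : IsZero (K.X i) := by
    by_cases h : i = 0
    · subst h; exact hK0
    · exact (hi h).of_iso (hK1 i h).some
  have hKge : K.IsStrictlyGE 1 := by
    rw [CochainComplex.isStrictlyGE_iff]
    exact fun i hi => hK i fun h => T.isZero_of_isStrictlyGE 0 i (by lia)
  -- The upper bound stays `n`, even for `n = 0` where `K` vanishes; the induction on length relies
  -- on this.
  have hKle : K.IsStrictlyLE n := by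
    rw [CochainComplex.isStrictlyLE_iff]
    exact fun i hi => hK i fun _ => T.isZero_of_isStrictlyLE n i hi
  let U : DerivedCategory.Bounded B :=
    ⟨DerivedCategory.Q.obj K, ⟨1, K, Iso.refl _, hKge⟩, ⟨n, K, Iso.refl _, hKle⟩⟩
  let i : U ⟶ Y := ObjectProperty.homMk (DerivedCategory.Q.map (kernel.ι p) ≫ e.inv)
  let π : Y ⟶ (single0 B).obj (T.X 0) := ObjectProperty.homMk (e.hom ≫ DerivedCategory.Q.map p)
  let μ : (single0 B).obj (T.X 0) ⟶ U⟦(1 : ℤ)⟧ :=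
    DerivedCategory.Bounded.ι.preimage (DerivedCategory.triangleOfSESδ hS ≫
      (DerivedCategory.Bounded.ι.commShiftIso (1 : ℤ)).inv.app U)
  refine ⟨Triangle.mk i π μ, ?_, rfl, ⟨K, hKge, hKle, fun i => ?_, ⟨Iso.refl _⟩⟩, T.X 0, hT 0, rfl⟩
  · refine isomorphic_distinguished _ (DerivedCategory.triangleOfSES_distinguished hS) _ ?_
    refine Triangle.isoMk _ _ (Iso.refl _) e (Iso.refl _) ?_ ?_ ?_
    · change (DerivedCategory.Q.map (kernel.ι p) ≫ e.inv) ≫ e.hom =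
        𝟙 _ ≫ DerivedCategory.Q.map (kernel.ι p)
      simp
    · change (e.hom ≫ DerivedCategory.Q.map p) ≫ 𝟙 _ = e.hom ≫ DerivedCategory.Q.map p
      simp
    · change (DerivedCategory.Bounded.ι.map μ ≫
        (DerivedCategory.Bounded.ι.commShiftIso (1 : ℤ)).hom.app U) ≫
          (shiftFunctor (DerivedCategory B) (1 : ℤ)).map (𝟙 _) =
            𝟙 _ ≫ DerivedCategory.triangleOfSESδ hS
      rw [Functor.map_preimage]
      exact comp_commShiftIso_aux U (DerivedCategory.triangleOfSESδ hS)
  · by_cases hi : i = 0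
    · subst hi; exact hK0.projective
    · obtain ⟨e⟩ := hK1 i hi
      exact Projective.of_iso e.symm (hT i)

end Bounded

/-! ### Composition of non-negative functors and of stable triangles -/

section Composition
variable {A : Type u} [Category.{v} A] [Abelian A] [HasDerivedCategory.{w} A]
  {B : Type u'} [Category.{v'} B] [Abelian B] [HasDerivedCategory.{w'} B]
  {C : Type u''} [Category.{v''} C] [Abelian C] [HasDerivedCategory.{w''} C]
  {F : DerivedCategory.Bounded A ⥤ DerivedCategory.Bounded B}
  {G : DerivedCategory.Bounded B ⥤ DerivedCategory.Bounded C} [G.CommShift ℤ] [G.IsTriangulated]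

lemma IsNonNegative.isGE (hF : IsNonNegative F) (X : A) :
    DerivedCategory.TStructure.t.IsGE (F.obj ((single0 A).obj X)).obj 0 :=
  (DerivedCategory.isGE_iff _ 0).2 fun i hi => hF.isZero_homology X i hi

/-- Here `n` counts the terms in degrees `0, …, n - 1`. Brutal truncation splits off the projective
in degree `0`; the rest, shifted by one, has one term fewer and starts again in degree `0`. Since
`G` commutes with the shift, the induction hypothesis applies, and closure under extensions
reassembles the pieces. -/
lemma IsNonNegative.exists_projComplexes_map_aux (hG : IsNonNegative G) (n : ℕ)
    (Y : DerivedCategory.Bounded B) (hY : projComplexes B 0 (n - 1) Y.obj) :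
    ∃ k, projComplexes C 0 k (G.obj Y).obj := by
  induction n generalizing Y with
  | zero =>
    refine ⟨0, projComplexes_of_isZero ?_⟩
    have hY' : IsZero Y := by
      obtain ⟨K, _, _, _, ⟨e⟩⟩ := hY
      -- For `n = 0` the upper bound is `-1`, so no degree is left.
      have hK : IsZero K := by
        rw [IsZero.iff_id_eq_zero]
        ext i
        by_cases hi : i < 0
        · exact (K.isZero_of_isStrictlyGE 0 i hi).eq_of_src _ _
        · exact (K.isZero_of_isStrictlyLE (((0 : ℕ) : ℤ) - 1) i (by lia)).eq_of_src _ _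
      have h := (DerivedCategory.Q.map_isZero hK).of_iso e
      rw [IsZero.iff_id_eq_zero]
      exact DerivedCategory.Bounded.ι.map_injective (h.eq_of_src _ _)
    exact DerivedCategory.Bounded.ι.map_isZero (G.map_isZero hY')
  | succ n ih =>
    obtain ⟨T, hT, rfl, hU, P, hP, h₃⟩ := exists_triangle_of_projComplexes Y hY
    obtain ⟨k, hk⟩ := ih (T.obj₁⟦(1 : ℤ)⟧)
      (projComplexes_mono (by lia) (by push_cast; lia) (projComplexes_shift_obj hU))
    obtain ⟨l, hl⟩ := hG.projComplexes_obj P hP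
    have hk' := projComplexes_of_shift_obj (projComplexes_of_iso
      (DerivedCategory.Bounded.ι.mapIso ((G.commShiftIso (1 : ℤ)).symm.app T.obj₁)) hk)
    rw [← h₃] at hl
    exact exists_projComplexes_obj₂ (G.mapTriangle.obj T) (G.map_distinguished _ hT)
      (projComplexes_mono (by lia) le_rfl hk') hl

/-- A non-negative functor preserves complexes of projective objects in non-negative degrees. -/
lemma IsNonNegative.exists_projComplexes_map (hG : IsNonNegative G) {n : ℤ}
    {Y : DerivedCategory.Bounded B} (hY : projComplexes B 0 n Y.obj) :
    ∃ k, projComplexes C 0 k (G.obj Y).obj :=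
  hG.exists_projComplexes_map_aux (n + 1).toNat Y (projComplexes_mono le_rfl (by lia) hY)

/-- The shift reduces this to degrees starting at `0`, as `G` commutes with it. -/
lemma IsNonNegative.exists_projComplexes_map_one (hG : IsNonNegative G) {n : ℤ}
    {Y : DerivedCategory.Bounded B} (hY : projComplexes B 1 n Y.obj) :
    ∃ k, projComplexes C 1 k (G.obj Y).obj := by
  obtain ⟨k, hk⟩ := hG.exists_projComplexes_map (projComplexes_shift_obj hY)
  exact ⟨_, projComplexes_of_shift_obj (projComplexes_of_iso
    (DerivedCategory.Bounded.ι.mapIso ((G.commShiftIso (1 : ℤ)).symm.app Y)) hk)⟩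

/-- `GF(X)` is an extension of `G(M_X)` by `G(U_X)`, and neither has homology in negative degrees.
-/
lemma IsNonNegative.comp [EnoughProjectives B] (hF : IsNonNegative F) (hG : IsNonNegative G) :
    IsNonNegative (F ⋙ G) where
  isZero_homology X := by
    obtain ⟨ξ⟩ := nonempty_stableTriangle _ (hF.isZero_homology X)
    obtain ⟨k, hk⟩ := hG.exists_projComplexes_map_one ξ.projComplexes_U
    exact (DerivedCategory.isGE_iff _ 0).1 (isGE_obj₂ _ (G.map_distinguished _ ξ.distinguished)
      (isGE_of_projComplexes (projComplexes_mono (by lia) le_rfl hk)) (hG.isGE ξ.M))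
  projComplexes_obj P hP := by
    obtain ⟨n, hn⟩ := hF.projComplexes_obj P hP
    exact hG.exists_projComplexes_map hn

lemma IsNonNegative.exists_comp_distinguished (hG : IsNonNegative G)
    {Y : DerivedCategory.Bounded B} (ξ : StableTriangle Y)
    (η : StableTriangle (G.obj ((single0 B).obj ξ.M))) :
    ∃ (W : DerivedCategory.Bounded C) (n : ℤ) (i : W ⟶ G.obj Y)
      (μ : (single0 C).obj η.M ⟶ W⟦(1 : ℤ)⟧), 0 < n ∧ projComplexes C 1 n W.obj ∧
        Triangle.mk i (G.map ξ.π ≫ η.π) μ ∈ distTriang (DerivedCategory.Bounded C) := by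
  obtain ⟨W, i, μ, hW⟩ := distinguished_cocone_triangle₁ (G.map ξ.π ≫ η.π)
  -- The octahedron on the composite of `G.map ξ.π` and `η.π` yields a triangle on their fibres,
  -- `G(ξ.U) ⟶ W ⟶ η.U`.
  have o := Triangulated.someOctahedron' rfl (G.map_distinguished _ ξ.distinguished)
    η.distinguished hW
  obtain ⟨k, hk⟩ := hG.exists_projComplexes_map_one ξ.projComplexes_U
  obtain ⟨l, hl⟩ := exists_projComplexes_obj₂ _ o.mem hk η.projComplexes_U
  exact ⟨W, max l 1, i, μ, by lia, projComplexes_mono le_rfl (by lia) hl, hW⟩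

/-- Stable triangles of `Y` and of `G(M)` compose to a stable triangle of `G(Y)`. -/
def StableTriangle.comp (hG : IsNonNegative G) {Y : DerivedCategory.Bounded B}
    (ξ : StableTriangle Y) (η : StableTriangle (G.obj ((single0 B).obj ξ.M))) :
    StableTriangle (G.obj Y) :=
  have h := hG.exists_comp_distinguished ξ η
  { U := h.choose
    -- `M` and `π` are given explicitly, not chosen, so that later comparisons with the iterated
    -- construction hold by definition.
    M := η.M
    n := h.choose_spec.choose
    n_pos := h.choose_spec.choose_spec.choose_spec.choose_spec.1
    projComplexes_U := h.choose_spec.choose_spec.choose_spec.choose_spec.2.1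
    i := h.choose_spec.choose_spec.choose
    π := G.map ξ.π ≫ η.π
    μ := h.choose_spec.choose_spec.choose_spec.choose
    distinguished := h.choose_spec.choose_spec.choose_spec.choose_spec.2.2 }

/-- The composites of the triangles chosen for `F` and for `G`. -/
def StableTriangles.comp (hG : IsNonNegative G) (ξ : StableTriangles F) (η : StableTriangles G) :
    StableTriangles (F ⋙ G) :=
  fun X => (ξ X).comp hG (η (ξ X).M)

/-- The iterated lift, which represents the composite of the stable functors, is thus an admissible
`b_f` for `F ⋙ G` and the composite triangles. -/
lemma StableTriangles.comp_π_comp_lift (hG : IsNonNegative G) (ξ : StableTriangles F)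
    (η : StableTriangles G) {X Y : A} (f : X ⟶ Y) :
    (ξ.comp hG η X).π ≫ (single0 C).map (η.lift (ξ.lift f)) =
      (F ⋙ G).map ((single0 A).map f) ≫ (ξ.comp hG η Y).π := by
  change (G.map (ξ X).π ≫ (η (ξ X).M).π) ≫ (single0 C).map (η.lift (ξ.lift f)) =
    G.map (F.map ((single0 A).map f)) ≫ G.map (ξ Y).π ≫ (η (ξ Y).M).π
  rw [Category.assoc, η.π_lift, ← Functor.map_comp_assoc, ξ.π_lift, Functor.map_comp_assoc]

end Composition

/-! ### Independence of the chosen triangle -/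

section Uniqueness
variable {A : Type u} [Category.{v} A] [Abelian A] [HasDerivedCategory.{w} A]
  {B : Type u'} [Category.{v'} B] [Abelian B] [HasDerivedCategory.{w'} B]

/-- The third objects of two stable triangles of the same object are stably isomorphic, compatibly
with the projections. -/
lemma StableTriangle.exists_stableIso {Y : DerivedCategory.Bounded B} (ξ ξ' : StableTriangle Y) :
    ∃ (e : (toStable B).obj ξ.M ≅ (toStable B).obj ξ'.M) (b : ξ.M ⟶ ξ'.M),
      e.hom = (toStable B).map b ∧ ξ.π ≫ (single0 B).map b = ξ'.π := by
  obtain ⟨b, hb⟩ := ξ.exists_lift ξ' (𝟙 Y)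
  obtain ⟨c, hc⟩ := ξ'.exists_lift ξ (𝟙 Y)
  rw [Category.id_comp] at hb hc
  -- Both `b ≫ c` and the identity agree after `ξ.π`, so their difference factors through a
  -- projective; likewise for `c ≫ b`.
  refine ⟨⟨(toStable B).map b, (toStable B).map c, ?_, ?_⟩, b, rfl, hb⟩
  · rw [← Functor.map_comp, ← CategoryTheory.Functor.map_id]
    exact CategoryTheory.Quotient.sound _ (ξ.factors_of_comp_eq_zero _ (by
      rw [Functor.map_sub, Functor.map_comp, Preadditive.comp_sub, reassoc_of% hb, hc]
      simp))
  · rw [← Functor.map_comp, ← CategoryTheory.Functor.map_id]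
    exact CategoryTheory.Quotient.sound _ (ξ'.factors_of_comp_eq_zero _ (by
      rw [Functor.map_sub, Functor.map_comp, Preadditive.comp_sub, reassoc_of% hc, hb]
      simp))

end Uniqueness

end
end StableFun

/-! ### The comparison isomorphism -/

theorem mainTheorem4
    {A : Type u₁} [Category.{v₁} A] [Abelian A] [EnoughProjectives A] [HasDerivedCategory.{w₁} A]
    {B : Type u₂} [Category.{v₂} B] [Abelian B] [EnoughProjectives B] [HasDerivedCategory.{w₂} B]
    {C : Type u₃} [Category.{v₃} C] [Abelian C] [EnoughProjectives C] [HasDerivedCategory.{w₃} C]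
    (F : DerivedCategory.Bounded A ⥤ DerivedCategory.Bounded B) [F.CommShift ℤ] [F.IsTriangulated]
    (G : DerivedCategory.Bounded B ⥤ DerivedCategory.Bounded C) [G.CommShift ℤ] [G.IsTriangulated]
    (hF : StableFun.IsNonNegative F) (hG : StableFun.IsNonNegative G) :
    ∃ hGF : StableFun.IsNonNegative (F ⋙ G),
      ∀ (ξ : StableFun.StableTriangles F) (η : StableFun.StableTriangles G)
        (ζ : StableFun.StableTriangles (F ⋙ G)),
        Nonempty (StableFun.stableFunctor hF ξ ⋙ StableFun.stableFunctor hG η ≅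
          StableFun.stableFunctor hGF ζ) := by
  refine ⟨hF.comp hG, fun ξ η ζ => ?_⟩
  choose e b he hb using fun X => StableFun.StableTriangle.exists_stableIso (ξ.comp hG η X) (ζ X)
  -- Stated for any admissible `g`, so that it applies to the iterated lift, which need not equal
  -- the lift chosen for the composite triangles.
  have h {X Y : A} (f : X ⟶ Y) (g : (ξ.comp hG η X).M ⟶ (ξ.comp hG η Y).M)
      (hg : (ξ.comp hG η X).π ≫ (StableFun.single0 C).map g =
        (F ⋙ G).map ((StableFun.single0 A).map f) ≫ (ξ.comp hG η Y).π) :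
      (StableFun.toStable C).map g ≫ (e Y).hom =
        (e X).hom ≫ (StableFun.toStable C).map (ζ.lift f) := by
    rw [he, he, ← Functor.map_comp, ← Functor.map_comp]
    refine (ξ.comp hG η).toStable_map_eq _ _ ?_
    rw [Functor.map_comp, Functor.map_comp, reassoc_of% (hb X), ζ.π_lift, ← hb Y, reassoc_of% hg]
    rfl
  -- Both functors start from a quotient of `A`, so naturality need only be checked on morphisms of
  -- `A`.
  exact ⟨CategoryTheory.Quotient.natIsoLift _ (NatIso.ofComponents e fun f =>
    h f (η.lift (ξ.lift f)) (ξ.comp_π_comp_lift hG η f))⟩
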